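/- **Theorem.** All rings are commutative with $1$ and lie in a fixed universe. A *$\mathbb{Z}$-functor* is a functor $X:\mathsf{CommRing}\to\mathsf{Set}$; write $\mathsf{Sp}(R)=\mathrm{Hom}(R,-)$, and call a $\mathbb{Z}$-functor *affine* if it is naturally isomorphic to $\mathsf{Sp}(R)$ for some ring $R$. A $\mathbb{Z}$-functor is *local* if it is a sheaf for the Zariski coverage on $\mathsf{CommRing}^{op}$, whose covering families of $R$ are the canonical maps $R\to R[1/f_i]$ for finitely many $f_1,\dots,f_n\in R$ ($n\ge 0$) with $1\in\langle f_1,\dots,f_n\rangle$. For a ring $R$ let $\mathcal{L}_R$ be its Zariski lattice: its elements $D(f_1,\dots,f_n)$ are the finite lists of elements of $R$, modulo $D(f_1,\dots,f_n)=D(g_1,\dots,g_m)$ iff $\sqrt{\langle f_1,\dots,f_n\rangle}=\sqrt{\langle g_1,\dots,g_m\rangle}$. It is a bounded distributive lattice with order given by inclusion of radical ideals, join by concatenation of lists, meet by the products $f_ig_j$, top $D(1)$ and bottom $D(0)$. A ring homomorphism $\varphi:A\to B$ induces $D(f_1,\dots,f_n)\mapsto D(\varphi(f_1),\dots,\varphi(f_n))$,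 which makes $\mathcal{L}$ a $\mathbb{Z}$-functor. A *compact open* of a $\mathbb{Z}$-functor $X$ is a natural transformation $U:X\Rightarrow\mathcal{L}$; compact opens of $X$ form a bounded distributive lattice with pointwise operations. The *realization* of $U$ is the $\mathbb{Z}$-functor $\llbracket U\rrbracket(R)=\{x\in X(R)\mid U(x)=D(1)\}$. Compact opens $U_1,\dots,U_n$ ($n\ge 0$) *cover* $X$ if $\bigvee_{i=1}^n U_i=1$ in this lattice, and $U$ is *affine* if $\llbracket U\rrbracket$ is affine. A *functorial qcqs-scheme* is a local $\mathbb{Z}$-functor for which there exists a finite cover by affine compact opens. Then for every functorial qcqs-scheme $X$ and every compact open $U:X\Rightarrow\mathcal{L}$, the realization $\llbracket U\rrbracket$ is again a functorial qcqs-scheme; that is, $\llbracket U\rrbracket$ is local and there exists a finite cover of $\llbracket U\rrbracket$ by affine compact opens of $\llbracket U\rrbracket$. -/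

import Mathlib

open CategoryTheory Opposite

universe u

/-! ### The Zariski lattice of a commutative ring -/

/-- Two lists of generators are equivalent if the radicals of the ideals they generate agree. -/
def zariskiSetoid (R : Type u) [CommRing R] : Setoid (List R) where
  r l m := (Ideal.span {x | x ∈ l}).radical = (Ideal.span {x | x ∈ m}).radical
  iseqv := ⟨fun _ => rfl, fun h => h.symm, fun h k => h.trans k⟩

/-- The Zariski lattice `𝓛_R`: finite lists of generators `f₁, …, fₙ` modulo taking the radical
of the ideal `⟨f₁, …, fₙ⟩`. -/
def ZariskiLattice (R : Type u) [CommRing R] : Type u := Quotient (zariskiSetoid R)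

namespace ZariskiLattice

variable {R S T : Type u} [CommRing R] [CommRing S] [CommRing T]

/-- The class `D(f₁, …, fₙ)` of a list of generators. -/
def ofList (l : List R) : ZariskiLattice R := Quotient.mk (zariskiSetoid R) l

/-- The basic open `D(f)`. -/
def D (f : R) : ZariskiLattice R := ofList [f]

/-- The radical ideal `√⟨f₁, …, fₙ⟩` of `D(f₁, …, fₙ)`. -/
def toIdeal (a : ZariskiLattice R) : Ideal R :=
  Quotient.lift (fun l : List R => (Ideal.span {x | x ∈ l}).radical) (by
    intro l m h
    exact h) a

theorem toIdeal_ofList (l : List R) :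
    (ofList l).toIdeal = (Ideal.span {x | x ∈ l}).radical := rfl

theorem toIdeal_injective : Function.Injective (toIdeal (R := R)) := by
  rintro ⟨l⟩ ⟨m⟩ h
  exact Quotient.sound h

theorem radical_toIdeal (a : ZariskiLattice R) : a.toIdeal.radical = a.toIdeal := by
  obtain ⟨l⟩ := a
  exact Ideal.radical_idem _

theorem span_append (l m : List R) :
    Ideal.span {x | x ∈ l ++ m} = Ideal.span {x | x ∈ l} ⊔ Ideal.span {x | x ∈ m} := by
  rw [← Ideal.span_union]
  congr 1
  ext x
  simp

/-- All products `fᵢ * gⱼ`. -/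
def products (l m : List R) : List R := l.flatMap fun f => m.map fun g => f * g

theorem span_products (l m : List R) :
    Ideal.span {x | x ∈ products l m} = Ideal.span {x | x ∈ l} * Ideal.span {x | x ∈ m} := by
  rw [Ideal.span_mul_span']
  congr 1
  ext x
  simp [products, Set.mem_mul]

theorem radical_span_append (l m : List R) :
    (Ideal.span {x | x ∈ l ++ m}).radical =
      ((Ideal.span {x | x ∈ l}).radical ⊔ (Ideal.span {x | x ∈ m}).radical).radical := by
  rw [span_append, Ideal.radical_sup]

theorem radical_span_products (l m : List R) :
    (Ideal.span {x | x ∈ products l m}).radical =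
      (Ideal.span {x | x ∈ l}).radical ⊓ (Ideal.span {x | x ∈ m}).radical := by
  rw [span_products, Ideal.radical_mul]

/-- `D(f₁, …, fₙ) ⊔ D(g₁, …, gₘ) = D(f₁, …, fₙ, g₁, …, gₘ)`. -/
def join : ZariskiLattice R → ZariskiLattice R → ZariskiLattice R :=
  Quotient.map₂ (fun l m => l ++ m) (by
    intro l l' hl m m' hm
    change Ideal.radical _ = Ideal.radical _ at hl hm
    change Ideal.radical _ = Ideal.radical _
    rw [radical_span_append, radical_span_append, hl, hm])

/-- `D(f₁, …, fₙ) ⊓ D(g₁, …, gₘ) = D(f₁g₁, …, fᵢgⱼ, …, fₙgₘ)`. -/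
def meet : ZariskiLattice R → ZariskiLattice R → ZariskiLattice R :=
  Quotient.map₂ products (by
    intro l l' hl m m' hm
    change Ideal.radical _ = Ideal.radical _ at hl hm
    change Ideal.radical _ = Ideal.radical _
    rw [radical_span_products, radical_span_products, hl, hm])

theorem toIdeal_join (a b : ZariskiLattice R) :
    (join a b).toIdeal = (a.toIdeal ⊔ b.toIdeal).radical := by
  obtain ⟨l⟩ := a
  obtain ⟨m⟩ := b
  exact radical_span_append l m

theorem toIdeal_meet (a b : ZariskiLattice R) :
    (meet a b).toIdeal = a.toIdeal ⊓ b.toIdeal := by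
  obtain ⟨l⟩ := a
  obtain ⟨m⟩ := b
  exact radical_span_products l m

/-- The Zariski lattice is a distributive lattice, ordered by inclusion of radical ideals. -/
instance : DistribLattice (ZariskiLattice R) where
  le a b := a.toIdeal ≤ b.toIdeal
  le_refl a := le_refl a.toIdeal
  le_trans a b c h k := le_trans (α := Ideal R) h k
  le_antisymm a b h k := toIdeal_injective (le_antisymm h k)
  sup := join
  inf := meet
  le_sup_left a b := by
    rw [toIdeal_join]
    exact le_sup_left.trans Ideal.le_radical
  le_sup_right a b := by
    rw [toIdeal_join]
    exact le_sup_right.trans Ideal.le_radical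
  sup_le a b c h k := by
    rw [toIdeal_join, ← radical_toIdeal c]
    exact Ideal.radical_mono (sup_le (α := Ideal R) h k)
  inf_le_left a b := by
    rw [toIdeal_meet]
    exact inf_le_left
  inf_le_right a b := by
    rw [toIdeal_meet]
    exact inf_le_right
  le_inf a b c h k := by
    rw [toIdeal_meet]
    exact le_inf (α := Ideal R) h k
  le_sup_inf a b c := by
    change (meet (join a b) (join a c)).toIdeal ≤ (join a (meet b c)).toIdeal
    rw [toIdeal_meet, toIdeal_join, toIdeal_join, toIdeal_join, toIdeal_meet, ← Ideal.radical_mul]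
    refine Ideal.radical_mono ?_
    rw [Ideal.sup_mul, Ideal.mul_sup, Ideal.mul_sup]
    exact sup_le (le_sup_of_le_left (sup_le Ideal.mul_le_right Ideal.mul_le_left))
      (sup_le (le_sup_of_le_left Ideal.mul_le_right) (le_sup_of_le_right Ideal.mul_le_inf))

theorem le_iff {a b : ZariskiLattice R} : a ≤ b ↔ a.toIdeal ≤ b.toIdeal := Iff.rfl

theorem ofList_sup (l m : List R) : ofList l ⊔ ofList m = ofList (l ++ m) := rfl

theorem ofList_inf (l m : List R) : ofList l ⊓ ofList m = ofList (products l m) := rfl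

/-- The top element is `D(1)` and the bottom element is `D(0)`. -/
instance : BoundedOrder (ZariskiLattice R) where
  top := D 1
  le_top a := by
    have h : (D (1 : R)).toIdeal = ⊤ := by simp [D, toIdeal_ofList, Ideal.radical_top]
    rw [le_iff, h]
    exact le_top
  bot := D 0
  bot_le a := by
    rw [le_iff, ← radical_toIdeal a]
    refine Ideal.radical_mono ?_
    simp

theorem top_eq : (⊤ : ZariskiLattice R) = D 1 := rfl

theorem bot_eq : (⊥ : ZariskiLattice R) = D 0 := rfl

theorem radical_span_map (φ : R →+* S) (l : List R) :
    (Ideal.span {x | x ∈ l.map φ}).radical =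
      ((Ideal.span {x | x ∈ l}).radical.map φ).radical := by
  have h : {x | x ∈ l.map φ} = φ '' {x | x ∈ l} := by ext; simp
  rw [h, ← Ideal.map_span]
  refine le_antisymm (Ideal.radical_mono (Ideal.map_mono Ideal.le_radical)) ?_
  rw [Ideal.radical_le_radical_iff]
  exact Ideal.map_radical_le φ

/-- The lattice homomorphism `φ^𝓛 : 𝓛_R → 𝓛_S` induced by a ring homomorphism `φ`, that is,
the unique one with `φ^𝓛 (D f) = D (φ f)`. It sends `D(f₁, …, fₙ)` to `D(φ f₁, …, φ fₙ)`. -/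
def map (φ : R →+* S) : BoundedLatticeHom (ZariskiLattice R) (ZariskiLattice S) where
  toFun := Quotient.map (List.map φ) (by
    intro l m h
    change Ideal.radical _ = Ideal.radical _ at h
    change Ideal.radical _ = Ideal.radical _
    rw [radical_span_map, radical_span_map, h])
  map_sup' := by
    rintro ⟨l⟩ ⟨m⟩
    change ofList ((l ++ m).map φ) = ofList (l.map φ ++ m.map φ)
    rw [List.map_append]
  map_inf' := by
    rintro ⟨l⟩ ⟨m⟩
    change ofList ((products l m).map φ) = ofList (products (l.map φ) (m.map φ))
    congr 1
    simp [products, List.map_flatMap, List.flatMap_map, Function.comp_def]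
  map_top' := by
    change ofList [φ 1] = ofList [1]
    rw [map_one]
  map_bot' := by
    change ofList [φ 0] = ofList [0]
    rw [map_zero]

theorem map_ofList (φ : R →+* S) (l : List R) : map φ (ofList l) = ofList (l.map φ) := rfl

theorem map_D (φ : R →+* S) (f : R) : map φ (D f) = D (φ f) := rfl

theorem map_id (a : ZariskiLattice R) : map (RingHom.id R) a = a := by
  obtain ⟨l⟩ := a
  change ofList (l.map (RingHom.id R)) = ofList l
  simp

theorem map_comp (ψ : S →+* T) (φ : R →+* S) (a : ZariskiLattice R) :
    map (ψ.comp φ) a = map ψ (map φ a) := by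
  obtain ⟨l⟩ := a
  change ofList (l.map (ψ.comp φ)) = ofList ((l.map φ).map ψ)
  simp

end ZariskiLattice

/-! ### `ℤ`-functors and the Zariski coverage -/

/-- `ℤ`-functors: functors from commutative rings to sets. -/
abbrev ZFunctor : Type (u + 1) := CommRingCat.{u} ⥤ Type u

/-- The affine `ℤ`-functor `Sp R = Hom(R, -)`. -/
abbrev ZFunctor.Sp (R : CommRingCat.{u}) : ZFunctor.{u} := coyoneda.obj (op R)

/-- `X` is an affine scheme if it is naturally isomorphic to some `Sp R`. -/
def ZFunctor.IsAffine (X : ZFunctor.{u}) : Prop :=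
  ∃ R : CommRingCat.{u}, Nonempty (X ≅ ZFunctor.Sp R)

/-- The canonical morphism `R[1/f] ⟶ R` in `CommRingᵒᵖ`. -/
noncomputable def basicOpenMap (R : CommRingCat.{u}) (f : R) :
    op (CommRingCat.of (Localization.Away f)) ⟶ op R :=
  (CommRingCat.ofHom (algebraMap R (Localization.Away f))).op

/-- The Zariski coverage on `CommRingᵒᵖ`: the covering families of `R` are the families
`R[1/fᵢ] ⟶ R` for finitely many `f₁, …, fₙ` (with `n = 0` allowed) such that
`1 ∈ ⟨f₁, …, fₙ⟩`. -/
noncomputable def zariskiCoverage : Coverage CommRingCat.{u}ᵒᵖ where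
  coverings R := {P | ∃ (n : ℕ) (f : Fin n → R.unop), (1 : R.unop) ∈ Ideal.span (Set.range f) ∧
    P = Presieve.ofArrows _ (fun i => basicOpenMap R.unop (f i))}
  pullback := by
    rintro R A φ _ ⟨n, f, hf, rfl⟩
    refine ⟨_, ⟨n, fun i => φ.unop (f i), ?_, rfl⟩, ?_⟩
    · have h := Ideal.mem_map_of_mem φ.unop.hom hf
      rw [map_one, Ideal.map_span, ← Set.range_comp] at h
      exact h
    · rintro _ _ ⟨i⟩
      let g : Localization.Away (f i) →+* Localization.Away (φ.unop (f i)) :=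
        Localization.awayMap φ.unop.hom (f i)
      refine ⟨_, (CommRingCat.ofHom g).op, _, ⟨i⟩, ?_⟩
      apply Quiver.Hom.unop_inj
      ext x
      change g (algebraMap R.unop (Localization.Away (f i)) x) =
        algebraMap A.unop (Localization.Away (φ.unop (f i))) (φ.unop.hom x)
      exact IsLocalization.map_eq _ x

/-- A `ℤ`-functor, regarded as a presheaf on `CommRingᵒᵖ`. -/
abbrev ZFunctor.toPresheaf (X : ZFunctor.{u}) : CommRingCat.{u}ᵒᵖᵒᵖ ⥤ Type u :=
  unopUnop CommRingCat.{u} ⋙ X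

/-- A `ℤ`-functor is local if it is a sheaf for the Zariski coverage. -/
def ZFunctor.IsLocal (X : ZFunctor.{u}) : Prop :=
  ∀ (R : CommRingCat.{u}ᵒᵖ) (P : Presieve R), P ∈ zariskiCoverage R → P.IsSheafFor X.toPresheaf

/-! ### Compact opens -/

/-- The `ℤ`-functor `𝓛` sending `R` to (the underlying set of) its Zariski lattice. -/
def zariskiFunctor : ZFunctor.{u} where
  obj R := ZariskiLattice R
  map φ := ↾fun a => ZariskiLattice.map φ.hom a
  map_id R := by
    ext a
    exact ZariskiLattice.map_id a
  map_comp φ ψ := by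
    ext a
    exact ZariskiLattice.map_comp ψ.hom φ.hom a

/-- A compact open of `X` is a natural transformation `U : X ⟶ 𝓛`. -/
def CompactOpen (X : ZFunctor.{u}) : Type (u + 1) := X ⟶ zariskiFunctor.{u}

namespace CompactOpen

variable {X : ZFunctor.{u}}

/-- The value `U(x) : 𝓛_R` of a compact open at `x : X(R)`. -/
def eval (U : CompactOpen X) {R : CommRingCat.{u}} (x : X.obj R) : ZariskiLattice R :=
  NatTrans.app U R x

theorem eval_map (U : CompactOpen X) {R S : CommRingCat.{u}} (φ : R ⟶ S) (x : X.obj R) :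
    U.eval (X.map φ x) = ZariskiLattice.map φ.hom (U.eval x) :=
  NatTrans.naturality_apply U φ x

theorem ext {U V : CompactOpen X}
    (h : ∀ (R : CommRingCat.{u}) (x : X.obj R), U.eval x = V.eval x) : U = V := by
  apply NatTrans.ext
  funext R
  ext x
  exact h R x

/-- A compact open from its natural family of values. -/
def mk (e : ∀ R : CommRingCat.{u}, X.obj R → ZariskiLattice R)
    (he : ∀ (R S : CommRingCat.{u}) (φ : R ⟶ S) (x : X.obj R),
      e S (X.map φ x) = ZariskiLattice.map φ.hom (e R x)) : CompactOpen X :=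
  { app := fun R => ↾(e R)
    naturality := fun R S φ => by
      ext x
      exact he R S φ x }

/-- The lattice structure on compact opens is pointwise. -/
instance : DistribLattice (CompactOpen X) where
  le U V := ∀ (R : CommRingCat.{u}) (x : X.obj R), U.eval x ≤ V.eval x
  le_refl U R x := le_refl _
  le_trans U V W h k R x := (h R x).trans (k R x)
  le_antisymm U V h k := ext fun R x => le_antisymm (h R x) (k R x)
  sup U V := mk (fun R x => U.eval x ⊔ V.eval x) fun R S φ x => by
    rw [eval_map, eval_map, map_sup]
  inf U V := mk (fun R x => U.eval x ⊓ V.eval x) fun R S φ x => by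
    rw [eval_map, eval_map, map_inf]
  le_sup_left U V R x := le_sup_left (α := ZariskiLattice R)
  le_sup_right U V R x := le_sup_right (α := ZariskiLattice R)
  sup_le U V W h k R x := sup_le (α := ZariskiLattice R) (h R x) (k R x)
  inf_le_left U V R x := inf_le_left (α := ZariskiLattice R)
  inf_le_right U V R x := inf_le_right (α := ZariskiLattice R)
  le_inf U V W h k R x := le_inf (α := ZariskiLattice R) (h R x) (k R x)
  le_sup_inf U V W R x := le_sup_inf (α := ZariskiLattice R)

/-- The top and bottom compact opens are constantly `D(1)` and `D(0)`. -/
instance : BoundedOrder (CompactOpen X) where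
  top := mk (fun _ _ => ZariskiLattice.D 1) fun R S φ x => by
    rw [ZariskiLattice.map_D, map_one]
  le_top U R x := le_top (α := ZariskiLattice R)
  bot := mk (fun _ _ => ZariskiLattice.D 0) fun R S φ x => by
    rw [ZariskiLattice.map_D, map_zero]
  bot_le U R x := bot_le (α := ZariskiLattice R)

/-- The realization `⟦U⟧` of a compact open `U` of `X`: the subfunctor of `X` with
`⟦U⟧(R) = {x : X(R) | U(x) = D(1)}`. -/
def realizationSubfunctor (U : CompactOpen X) : Subfunctor X where
  obj R := {x | U.eval x = ZariskiLattice.D 1}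
  map {R S} φ x hx := by
    change U.eval (X.map φ x) = ZariskiLattice.D 1
    have hx' : U.eval x = ZariskiLattice.D 1 := hx
    rw [eval_map, hx', ZariskiLattice.map_D, map_one]

/-- The realization `⟦U⟧` as a `ℤ`-functor. -/
def realization (U : CompactOpen X) : ZFunctor.{u} := U.realizationSubfunctor.toFunctor

/-- A compact open is affine if its realization is an affine scheme. -/
def IsAffine (U : CompactOpen X) : Prop := U.realization.IsAffine

/-- `U₁, …, Uₙ` is a compact open cover of `X` if `⋁ᵢ Uᵢ = 1` in the lattice of compact opens. -/
def IsCover {n : ℕ} (U : Fin n → CompactOpen X) : Prop := Finset.univ.sup U = ⊤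

end CompactOpen

/-- A functorial qcqs-scheme is a local `ℤ`-functor with a finite cover by affine compact
opens. -/
structure ZFunctor.IsQcqsScheme (X : ZFunctor.{u}) : Prop where
  isLocal : X.IsLocal
  exists_affine_cover : ∃ (n : ℕ) (U : Fin n → CompactOpen X),
    CompactOpen.IsCover U ∧ ∀ i, (U i).IsAffine

/-! ### Order and localization in the Zariski lattice -/

namespace ZariskiLattice

variable {R : Type u} [CommRing R]

/-! Locality of `⟦U⟧` follows from that of `X`, since the value `1` in `𝓛` is detected on Zariski
covers (`eq_top_of_cover`). For the cover, let `W` be an affine member of a cover of `X`, with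
universal point `ξ` over `A`, and write `U(ξ) = D(f₁, …, fₙ)`. Each `D(fⱼ)` is a compact open of
`⟦W⟧`; once extended to `X` and restricted to `⟦U⟧`, it is represented by `A[1/fⱼ]`
(`isAffine_restrict`). Together these opens cover the part of `⟦U⟧` in `W`. The crux is
`exists_extension`: to extend `V` from `⟦W⟧` to `X` at a point `x` with `W(x) = D(g₁, …, gₘ)`, lift
its value over each `R[1/gₖ]` to `𝓛_R`, cut by `D(gₖ)` and join. Being below `W(x)`, the result is
determined by its restrictions to `⟦W⟧`, hence natural. -/

theorem mem_toIdeal_pow {a : ZariskiLattice R} {x : R} (n : ℕ) (h : x ^ n ∈ a.toIdeal) :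
    x ∈ a.toIdeal := by
  rw [← radical_toIdeal a]
  exact ⟨n, h⟩

theorem toIdeal_D (f : R) : (D f).toIdeal = (Ideal.span {f}).radical := by
  simp [D, toIdeal_ofList]

theorem D_le_iff {f : R} {a : ZariskiLattice R} : D f ≤ a ↔ f ∈ a.toIdeal := by
  rw [le_iff, toIdeal_D, ← radical_toIdeal a, Ideal.radical_le_radical_iff, radical_toIdeal,
    Ideal.span_singleton_le_iff_mem]

theorem D_eq_top_iff {f : R} : D f = ⊤ ↔ IsUnit f := by
  rw [eq_top_iff, top_eq, D_le_iff, toIdeal_D, ← Ideal.eq_top_iff_one, Ideal.radical_eq_top,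
    Ideal.span_singleton_eq_top]

theorem toIdeal_map {S : Type u} [CommRing S] (φ : R →+* S) (a : ZariskiLattice R) :
    (map φ a).toIdeal = (a.toIdeal.map φ).radical := by
  obtain ⟨l⟩ := a
  exact radical_span_map φ l

theorem ofList_le_iff {l : List R} {a : ZariskiLattice R} :
    ofList l ≤ a ↔ ∀ f ∈ l, D f ≤ a := by
  simp_rw [D_le_iff]
  rw [le_iff, toIdeal_ofList, ← radical_toIdeal a, Ideal.radical_le_radical_iff, radical_toIdeal,
    Ideal.span_le]
  rfl

theorem exists_ofList (a : ZariskiLattice R) : ∃ l, a = ofList l := by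
  obtain ⟨l⟩ := a
  exact ⟨l, rfl⟩

/-- Over `D(g)`, the order is detected after inverting `g`. -/
theorem D_inf_le_of_map_le (g : R) {a b : ZariskiLattice R}
    (h : map (algebraMap R (Localization.Away g)) a ≤
      map (algebraMap R (Localization.Away g)) b) : D g ⊓ a ≤ b := by
  rw [le_iff, toIdeal_map, toIdeal_map] at h
  change (meet (D g) a).toIdeal ≤ b.toIdeal
  rw [toIdeal_meet, toIdeal_D]
  rintro x ⟨⟨m, hm⟩, hx⟩
  obtain ⟨n, hn⟩ := h (Ideal.le_radical (Ideal.mem_map_of_mem _ hx))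
  rw [← map_pow, IsLocalization.algebraMap_mem_map_algebraMap_iff (Submonoid.powers g)] at hn
  obtain ⟨_, ⟨k, rfl⟩, hk⟩ := hn
  -- `x ^ m` is a multiple of `g`, so `x ^ (m * k)` supplies the factor `g ^ k` that clears the
  -- denominator of `x ^ n`.
  refine mem_toIdeal_pow (m * k + n) ?_
  obtain ⟨r, hr⟩ := Ideal.mem_span_singleton'.1 hm
  rw [pow_add, pow_mul, ← hr, mul_pow, mul_assoc]
  exact Ideal.mul_mem_left _ _ hk

/-- Every element of the Zariski lattice of a localization is the image of some element. -/
theorem map_algebraMap_surjective (g : R) :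
    Function.Surjective (map (algebraMap R (Localization.Away g))) := by
  intro a
  obtain ⟨l, rfl⟩ := exists_ofList a
  choose n hn using fun x : Localization.Away g =>
    IsLocalization.surj (Submonoid.powers g) x
  refine ⟨ofList (l.map fun x => (n x).1), ?_⟩
  -- A fraction and its numerator differ by a unit.
  have key : ∀ x, D (algebraMap R (Localization.Away g) (n x).1) = D x := fun x => by
    apply toIdeal_injective
    rw [toIdeal_D, toIdeal_D, ← hn x,
      Ideal.span_singleton_mul_right_unit (IsLocalization.map_units _ (n x).2)]
  rw [map_ofList]
  apply le_antisymm <;> rw [ofList_le_iff]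
  · intro f hf
    simp only [List.map_map, List.mem_map, Function.comp_apply] at hf
    obtain ⟨x, hx, rfl⟩ := hf
    rw [key]
    exact ofList_le_iff.1 le_rfl x hx
  · intro x hx
    rw [← key]
    refine ofList_le_iff.1 le_rfl _ ?_
    simp only [List.map_map, List.mem_map, Function.comp_apply]
    exact ⟨x, hx, rfl⟩

theorem map_algebraMap_D (g : R) : map (algebraMap R (Localization.Away g)) (D g) = ⊤ := by
  rw [map_D, D_eq_top_iff]
  exact IsLocalization.Away.algebraMap_isUnit g

theorem D_inf_eq_of_map_eq (g : R) {a b : ZariskiLattice R}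
    (h : map (algebraMap R (Localization.Away g)) a =
      map (algebraMap R (Localization.Away g)) b) : D g ⊓ a = D g ⊓ b :=
  le_antisymm (le_inf inf_le_left (D_inf_le_of_map_le g h.le))
    (le_inf inf_le_left (D_inf_le_of_map_le g h.ge))

theorem D_le_of_map_eq_top (g : R) {b : ZariskiLattice R}
    (h : map (algebraMap R (Localization.Away g)) b = ⊤) : D g ≤ b := by
  have := D_inf_le_of_map_le g (a := ⊤) (b := b) (by rw [h]; exact le_top)
  rwa [inf_top_eq] at this

/-- The element `1` of the Zariski lattice is detected on Zariski covers. -/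
theorem eq_top_of_cover {ι : Type*} (f : ι → R) (hf : (1 : R) ∈ Ideal.span (Set.range f))
    {a : ZariskiLattice R}
    (h : ∀ i, map (algebraMap R (Localization.Away (f i))) a = ⊤) : a = ⊤ := by
  rw [eq_top_iff, top_eq, D_le_iff]
  refine Ideal.span_le.2 ?_ hf
  rintro _ ⟨i, rfl⟩
  exact D_le_iff.1 (D_le_of_map_eq_top _ (h i))

end ZariskiLattice

open ZariskiLattice

/-! ### Locality of realizations -/

namespace CompactOpen

variable {X : ZFunctor.{u}}

theorem realization_isLocal (hX : X.IsLocal) (U : CompactOpen X) : U.realization.IsLocal := by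
  intro R P hP x hx
  have hx' : Presieve.FamilyOfElements.Compatible (P := X.toPresheaf)
      (fun Y g hg => (x g hg).1) :=
    fun _ _ _ g₁ g₂ _ _ h₁ h₂ h => congrArg Subtype.val (hx g₁ g₂ h₁ h₂ h)
  obtain ⟨t, ht, huniq⟩ := hX R P hP _ hx'
  obtain ⟨n, f, hf, rfl⟩ := hP
  have hU : U.eval t = ⊤ := by
    refine eq_top_of_cover f hf fun i => ?_
    have h := ht _ ⟨i⟩
    have h2 := U.eval_map (CommRingCat.ofHom (algebraMap R.unop (Localization.Away (f i)))) t
    refine h2.symm.trans ?_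
    refine (congrArg U.eval h).trans ?_
    exact (x _ ⟨i⟩).2
  refine ⟨⟨t, hU⟩, fun Y g hg => Subtype.ext (ht g hg), fun y hy => Subtype.ext ?_⟩
  exact huniq y.1 fun Y g hg => congrArg Subtype.val (hy g hg)

end CompactOpen

/-! ### Extending compact opens from `⟦W⟧` to `X` -/

namespace ZariskiLattice

variable {R : Type u} [CommRing R]

theorem ofList_nil : ofList ([] : List R) = ⊥ :=
  bot_unique (ofList_le_iff.2 (by simp))

theorem ofList_cons (f : R) (l : List R) : ofList (f :: l) = D f ⊔ ofList l := rfl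

theorem ofList_inf_le {l : List R} {a b : ZariskiLattice R}
    (h : ∀ f ∈ l, D f ⊓ a ≤ b) : ofList l ⊓ a ≤ b := by
  induction l with
  | nil => rw [ofList_nil, bot_inf_eq]; exact bot_le
  | cons f l ih =>
    rw [ofList_cons, inf_sup_right]
    exact sup_le (h f (by simp)) (ih fun g hg => h g (by simp [hg]))

end ZariskiLattice

namespace CompactOpen

variable {X : ZFunctor.{u}}

/-- The canonical map `R ⟶ R[1/g]`. -/
noncomputable abbrev awayHom {R : CommRingCat.{u}} (g : R) :
    R ⟶ CommRingCat.of (Localization.Away g) :=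
  CommRingCat.ofHom (algebraMap R (Localization.Away g))

theorem eval_awayHom (W : CompactOpen X) {R : CommRingCat.{u}} (x : X.obj R) {g : R}
    (hg : D g ≤ W.eval x) : W.eval (X.map (awayHom g) x) = ⊤ := by
  rw [eval_map, ← top_le_iff, ← map_algebraMap_D g]
  exact OrderHomClass.mono (map (algebraMap R (Localization.Away g))) hg

/-- Below `W(x)`, the order is detected on the points of `⟦W⟧` over `x`. -/
theorem eval_inf_le (W : CompactOpen X) {R : CommRingCat.{u}} (x : X.obj R)
    {a b : ZariskiLattice R}
    (h : ∀ (S : CommRingCat.{u}) (φ : R ⟶ S), W.eval (X.map φ x) = ⊤ →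
      map φ.hom a ≤ map φ.hom b) : W.eval x ⊓ a ≤ b := by
  obtain ⟨l, hl⟩ := exists_ofList (W.eval x)
  rw [hl]
  refine ofList_inf_le fun g hg => D_inf_le_of_map_le g (h _ (awayHom g) ?_)
  exact eval_awayHom W x (hl ▸ ofList_le_iff.1 le_rfl g hg)

theorem eval_le (W : CompactOpen X) {R : CommRingCat.{u}} (x : X.obj R) {c : ZariskiLattice R}
    (h : ∀ (S : CommRingCat.{u}) (φ : R ⟶ S), W.eval (X.map φ x) = ⊤ → map φ.hom c = ⊤) :
    W.eval x ≤ c := by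
  rw [← inf_top_eq (W.eval x)]
  exact eval_inf_le W x fun S φ hφ => by rw [h S φ hφ]; exact le_top

/-- A point of `X` on which `W` is `1`, as a point of the realization. -/
def lift (W : CompactOpen X) {R : CommRingCat.{u}} (x : X.obj R) (hx : W.eval x = ⊤) :
    W.realization.obj R := ⟨x, hx⟩

theorem lift_congr (W : CompactOpen X) {R : CommRingCat.{u}} {x y : X.obj R} (h : x = y)
    (hx : W.eval x = ⊤) (hy : W.eval y = ⊤) : W.lift x hx = W.lift y hy := by
  subst h; rfl

/-- Each `g` in the list contributes `D g ⊓ c`, where `c` lifts the value of `V` at `x` over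
`R[1/g]`. Quantifying over all `φ` builds base change into the induction. -/
theorem exists_local_extension (W : CompactOpen X) (V : CompactOpen W.realization)
    {R : CommRingCat.{u}} (x : X.obj R) (l : List R) (hl : ofList l ≤ W.eval x) :
    ∃ v ≤ ofList l, ∀ (S : CommRingCat.{u}) (φ : R ⟶ S) (h : W.eval (X.map φ x) = ⊤),
      map φ.hom v = map φ.hom (ofList l) ⊓ V.eval (W.lift _ h) := by
  induction l with
  | nil =>
    refine ⟨⊥, bot_le, fun S φ h => ?_⟩
    rw [ofList_nil, map_bot, bot_inf_eq]
  | cons g l ih =>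
    rw [ofList_cons, sup_le_iff] at hl
    obtain ⟨v, hv, hv'⟩ := ih hl.2
    have hg := eval_awayHom W x hl.1
    obtain ⟨c, hc⟩ := map_algebraMap_surjective g (V.eval (W.lift _ hg))
    refine ⟨D g ⊓ c ⊔ v, ?_, fun S φ h => ?_⟩
    · rw [ofList_cons]
      exact sup_le_sup inf_le_left hv
    · rw [ofList_cons, map_sup, map_sup, map_inf, hv' S φ h, inf_sup_right]
      congr 1
      rw [map_D]
      -- Over `S[1/φ(g)]` both sides are the image of the value of `V` over `R[1/g]`.
      apply D_inf_eq_of_map_eq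
      let ψ : CommRingCat.of (Localization.Away g) ⟶
          CommRingCat.of (Localization.Away (φ.hom g)) :=
        CommRingCat.ofHom (Localization.awayMap φ.hom g)
      have hψ : awayHom g ≫ ψ = φ ≫ awayHom (φ.hom g) := by
        ext y
        change Localization.awayMap φ.hom g (algebraMap R (Localization.Away g) y) =
          algebraMap S (Localization.Away (φ.hom g)) (φ.hom y)
        exact IsLocalization.map_eq _ y
      have hX : X.map ψ (X.map (awayHom g) x) = X.map (awayHom (φ.hom g)) (X.map φ x) := by
        rw [← Functor.map_comp_apply, hψ, Functor.map_comp_apply]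
      have h₁ : W.eval (X.map ψ (X.map (awayHom g) x)) = ⊤ := by rw [eval_map, hg, map_top]
      have h₂ : W.eval (X.map (awayHom (φ.hom g)) (X.map φ x)) = ⊤ := by
        rw [eval_map, h, map_top]
      calc map (awayHom (φ.hom g)).hom (map φ.hom c)
          = map (φ ≫ awayHom (φ.hom g)).hom c := (map_comp _ _ _).symm
        _ = map (awayHom g ≫ ψ).hom c := by rw [hψ]
        _ = map ψ.hom (map (awayHom g).hom c) := map_comp _ _ _
        _ = map ψ.hom (V.eval (W.lift _ hg)) := by rw [← hc]; rfl
        _ = V.eval (W.lift _ h₁) := by rw [← eval_map]; rfl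
        _ = V.eval (W.lift _ h₂) := by rw [lift_congr W hX h₁ h₂]
        _ = map (awayHom (φ.hom g)).hom (V.eval (W.lift _ h)) := by rw [← eval_map]; rfl

theorem exists_eval_extension (W : CompactOpen X) (V : CompactOpen W.realization)
    {R : CommRingCat.{u}} (x : X.obj R) :
    ∃ v ≤ W.eval x, ∀ (S : CommRingCat.{u}) (φ : R ⟶ S) (h : W.eval (X.map φ x) = ⊤),
      map φ.hom v = V.eval (W.lift _ h) := by
  obtain ⟨l, hl⟩ := exists_ofList (W.eval x)
  obtain ⟨v, hv, hv'⟩ := exists_local_extension W V x l hl.ge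
  refine ⟨v, hl ▸ hv, fun S φ h => ?_⟩
  rw [hv' S φ h, ← hl, ← eval_map, h, top_inf_eq]

/-- A compact open of `⟦W⟧` extends to a compact open of `X` contained in `W`. -/
theorem exists_extension (W : CompactOpen X) (V : CompactOpen W.realization) :
    ∃ V' : CompactOpen X, V' ≤ W ∧ ∀ (R : CommRingCat.{u}) (x : X.obj R) (h : W.eval x = ⊤),
      V'.eval x = V.eval (W.lift x h) := by
  -- The choices at different points are independent; uniqueness below `W` makes them natural.
  choose v hv hv' using fun (R : CommRingCat.{u}) (x : X.obj R) =>
    exists_eval_extension W V x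
  have key : ∀ (R S : CommRingCat.{u}) (φ : R ⟶ S) (x : X.obj R) (T : CommRingCat.{u})
      (ψ : S ⟶ T), W.eval (X.map ψ (X.map φ x)) = ⊤ →
      map ψ.hom (v S (X.map φ x)) = map ψ.hom (map φ.hom (v R x)) := by
    intro R S φ x T ψ h
    have hX : X.map (φ ≫ ψ) x = X.map ψ (X.map φ x) := Functor.map_comp_apply ..
    have h' : W.eval (X.map (φ ≫ ψ) x) = ⊤ := hX ▸ h
    rw [hv' S _ T ψ h, ← map_comp]
    exact ((hv' R x T (φ ≫ ψ) h').trans (by rw [lift_congr W hX h' h])).symm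
  refine ⟨mk v fun R S φ x => ?_, hv, fun R x h => ?_⟩
  · have hle : map φ.hom (v R x) ≤ W.eval (X.map φ x) := by
      rw [eval_map]
      exact OrderHomClass.mono (map φ.hom) (hv R x)
    apply le_antisymm
    · rw [← inf_eq_right.2 (hv S (X.map φ x))]
      exact eval_inf_le W _ fun T ψ h => (key R S φ x T ψ h).le
    · rw [← inf_eq_right.2 hle]
      exact eval_inf_le W _ fun T ψ h => (key R S φ x T ψ h).ge
  · have hX : X.map (𝟙 R) x = x := Functor.map_id_apply ..
    have h' : W.eval (X.map (𝟙 R) x) = ⊤ := hX.symm ▸ h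
    have := hv' R x R (𝟙 R) h'
    rw [lift_congr W hX h' h] at this
    exact (map_id _).symm.trans this

end CompactOpen

/-! ### Representability by universal points -/

/-- An element `ξ : F(A)` is universal if every element of `F(S)` is the image of `ξ` under a
unique ring homomorphism `A ⟶ S`. -/
def ZFunctor.IsUniversal (F : ZFunctor.{u}) {A : CommRingCat.{u}} (ξ : F.obj A) : Prop :=
  ∀ (S : CommRingCat.{u}) (y : F.obj S), ∃! φ : A ⟶ S, F.map φ ξ = y

theorem ZFunctor.isAffine_iff (F : ZFunctor.{u}) :
    F.IsAffine ↔ ∃ (A : CommRingCat.{u}) (ξ : F.obj A), F.IsUniversal ξ := by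
  constructor
  · rintro ⟨A, ⟨e⟩⟩
    have he (S : CommRingCat.{u}) (φ : A ⟶ S) :
        F.map φ (e.inv.app A (𝟙 A)) = e.inv.app S φ := by
      rw [← NatTrans.naturality_apply]
      exact congrArg (e.inv.app S) (Category.id_comp φ)
    refine ⟨A, e.inv.app A (𝟙 A), fun S y => ⟨e.hom.app S y, ?_, fun φ hφ => ?_⟩⟩
    · exact (he S _).trans (e.hom_inv_id_app_apply S y)
    · rw [← hφ, he]
      exact (e.inv_hom_id_app_apply S φ).symm
  · rintro ⟨A, ξ, hξ⟩
    refine ⟨A, ⟨?_⟩⟩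
    let τ : ZFunctor.Sp A ⟶ F := coyonedaEquiv.symm ξ
    have : ∀ S, IsIso (τ.app S) := fun S => by
      rw [isIso_iff_bijective]
      refine ⟨fun φ ψ h => ?_, fun y => ?_⟩
      · exact (hξ S (F.map φ ξ)).unique rfl h.symm
      · obtain ⟨φ, hφ, -⟩ := hξ S y
        exact ⟨φ, hφ⟩
    have : IsIso τ := NatIso.isIso_of_isIso_app τ
    exact (asIso τ).symm

/-! ### Affine covers of `⟦U⟧` -/

namespace CompactOpen

variable {X : ZFunctor.{u}}

/-- An affine `ℤ`-functor has a compact open with any prescribed value at the universal point. -/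
theorem exists_eval_universal {F : ZFunctor.{u}} {A : CommRingCat.{u}} {ξ : F.obj A}
    (hξ : F.IsUniversal ξ) (a : ZariskiLattice A) : ∃ V : CompactOpen F, V.eval ξ = a := by
  choose φ hφ hφ' using hξ
  refine ⟨mk (fun S y => map (φ S y).hom a) fun R S ψ y => ?_, ?_⟩
  · rw [← map_comp, ← CommRingCat.hom_comp, hφ' S (F.map ψ y) (φ R y ≫ ψ)]
    change F.map (φ R y ≫ ψ) ξ = F.map ψ y
    rw [Functor.map_comp_apply, hφ]
  · have h : φ A ξ = 𝟙 A := (hφ' A ξ (𝟙 A) (Functor.map_id_apply ..)).symm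
    change map (φ A ξ).hom a = a
    rw [h]
    exact map_id a

/-- The restriction of a compact open of `X` to `⟦U⟧`. -/
def restrict (U V : CompactOpen X) : CompactOpen U.realization :=
  mk (fun _ y => V.eval y.1) fun _ _ φ y => V.eval_map φ y.1

/-- A point of the realization lies in `⟦W⟧`, so it comes from a unique `φ : A ⟶ S`; that `V` is `1`
there means that `φ f` is a unit, so `φ` factors through `A[1/f]`. The bound `hU` puts the image of
`ξ` over `A[1/f]` in `⟦U⟧`. -/
theorem isAffine_restrict {U V W : CompactOpen X} {A : CommRingCat.{u}} {ξ : W.realization.obj A}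
    (hξ : W.realization.IsUniversal ξ) {f : A} (hVW : V ≤ W) (hV : V.eval ξ.1 = D f)
    (hU : D f ≤ U.eval ξ.1) : (U.restrict V).IsAffine := by
  refine (ZFunctor.isAffine_iff _).2 ?_
  have hV' : V.eval (X.map (awayHom f) ξ.1) = ⊤ := eval_awayHom V ξ.1 hV.ge
  have hU' : U.eval (X.map (awayHom f) ξ.1) = ⊤ := eval_awayHom U ξ.1 hU
  refine ⟨CommRingCat.of (Localization.Away f), (U.restrict V).lift (U.lift _ hU') hV', ?_⟩
  intro S y
  have hyV : V.eval y.1.1 = ⊤ := y.2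
  have hyW : W.eval y.1.1 = ⊤ := top_le_iff.1 (hyV ▸ hVW S y.1.1)
  obtain ⟨φ, hφ, huniq⟩ := hξ S (W.lift y.1.1 hyW)
  have hφX : X.map φ ξ.1 = y.1.1 := congrArg Subtype.val hφ
  have hunit : IsUnit (φ.hom f) := by
    rw [← D_eq_top_iff, ← map_D, ← hV, ← eval_map, hφX, hyV]
  let ψ : CommRingCat.of (Localization.Away f) ⟶ S :=
    CommRingCat.ofHom (IsLocalization.Away.lift f hunit)
  have hψ : awayHom f ≫ ψ = φ := by
    ext a
    exact IsLocalization.Away.lift_eq f hunit a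
  refine ⟨ψ, Subtype.ext (Subtype.ext ?_), fun χ hχ => ?_⟩
  · change X.map ψ (X.map (awayHom f) ξ.1) = y.1.1
    rw [← Functor.map_comp_apply, hψ, hφX]
  · have h : X.map χ (X.map (awayHom f) ξ.1) = y.1.1 :=
      congrArg (fun z => z.1.1) hχ
    have h' : awayHom f ≫ χ = φ := by
      refine huniq _ (Subtype.ext ?_)
      change X.map (awayHom f ≫ χ) ξ.1 = y.1.1
      rw [Functor.map_comp_apply, h]
    have h'' := h'.trans hψ.symm
    ext1
    apply IsLocalization.ringHom_ext (Submonoid.powers f)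
    exact congrArg CommRingCat.Hom.hom h''

theorem eval_sup {ι : Type*} (s : Finset ι) (V : ι → CompactOpen X) {R : CommRingCat.{u}}
    (x : X.obj R) : (s.sup V).eval x = s.sup fun i => (V i).eval x :=
  Finset.apply_sup_eq_sup_comp (fun V : CompactOpen X => V.eval x) (fun _ _ => rfl) rfl

/-- A cover indexed by a finite type can be indexed by `Fin n`. -/
theorem exists_fin_cover {ι : Type*} [Finite ι] (V : ι → CompactOpen X)
    (hV : ∀ C : CompactOpen X, (∀ i, V i ≤ C) → C = ⊤) (hA : ∀ i, (V i).IsAffine) :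
    ∃ (n : ℕ) (U : Fin n → CompactOpen X), IsCover U ∧ ∀ i, (U i).IsAffine := by
  obtain ⟨n, ⟨e⟩⟩ := Finite.exists_equiv_fin ι
  refine ⟨n, fun i => V (e.symm i), hV _ fun i => ?_, fun i => hA _⟩
  have h := Finset.le_sup (f := fun i => V (e.symm i)) (Finset.mem_univ (e i))
  simpa using h

/-- In an affine compact open `W`, finitely many affine compact opens of `⟦U⟧` cover `W ⊓ U`. -/
theorem exists_affine_cover_inf (U W : CompactOpen X) (hW : W.IsAffine) :
    ∃ (n : ℕ) (V : Fin n → CompactOpen U.realization), (∀ i, (V i).IsAffine) ∧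
      ∀ C : CompactOpen U.realization, (∀ i, V i ≤ C) → U.restrict W ≤ C := by
  obtain ⟨A, ξ, hξ⟩ := (ZFunctor.isAffine_iff _).1 hW
  obtain ⟨l, hl⟩ := exists_ofList (U.eval ξ.1)
  have hex (f : A) : ∃ V ≤ W, V.eval ξ.1 = D f := by
    obtain ⟨V, hV⟩ := exists_eval_universal hξ (D f)
    obtain ⟨V', hle, hV'⟩ := exists_extension W V
    exact ⟨V', hle, (hV' A ξ.1 ξ.2).trans hV⟩
  choose V hVW hV using hex
  refine ⟨l.length, fun i => U.restrict (V (l.get i)), fun i => ?_, fun C hC R x => ?_⟩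
  · refine isAffine_restrict hξ (hVW _) (hV _) ?_
    rw [hl]
    exact ofList_le_iff.1 le_rfl _ (l.get_mem i)
  · refine eval_le (U.restrict W) x fun S φ hφ => ?_
    rw [← eval_map]
    obtain ⟨ψ, hψ, -⟩ := hξ S (W.lift (U.realization.map φ x).1 hφ)
    have hψX : X.map ψ ξ.1 = (U.realization.map φ x).1 := congrArg Subtype.val hψ
    -- A point in both `U` and `W` is the image of `ξ` under `ψ`, so the pullbacks of the `D(f)`
    -- with `f ∈ l` join to `1` there.
    have hUx : map ψ.hom (ofList l) = ⊤ := by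
      rw [← hl, ← eval_map, hψX]
      exact (U.realization.map φ x).2
    rw [eq_top_iff, ← hUx, map_ofList, ofList_le_iff]
    intro g hg
    obtain ⟨f, hf, rfl⟩ := List.mem_map.1 hg
    obtain ⟨i, rfl⟩ := List.get_of_mem hf
    refine le_trans (le_of_eq ?_) (hC i S (U.realization.map φ x))
    change _ = (V (l.get i)).eval (U.realization.map φ x).1
    rw [← hψX, eval_map, hV]
    rfl

end CompactOpen

theorem mainTheorem6 (X : ZFunctor.{u}) (hX : X.IsQcqsScheme) (U : CompactOpen X) :
    U.realization.IsQcqsScheme := by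
  refine ⟨CompactOpen.realization_isLocal hX.isLocal U, ?_⟩
  obtain ⟨n, W, hW, hA⟩ := hX.exists_affine_cover
  choose m V hV hC using fun i => CompactOpen.exists_affine_cover_inf U (W i) (hA i)
  refine CompactOpen.exists_fin_cover (ι := Σ i, Fin (m i)) (fun p => V p.1 p.2)
    (fun C h => ?_) fun p => hV p.1 p.2
  -- It suffices to dominate each `W i` on `⟦U⟧`, as these already join to `1` on `X`.
  have hle (i) : U.restrict (W i) ≤ C := hC i C fun j => h ⟨i, j⟩
  refine top_le_iff.1 fun R x => ?_
  have hx : Finset.univ.sup (fun i => (W i).eval x.1) = ⊤ := by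
    rw [← CompactOpen.eval_sup, hW]
    rfl
  change ⊤ ≤ C.eval x
  rw [← hx]
  exact Finset.sup_le fun i _ => hle i R x
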